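/- **Lemma.** Let $n\ge 1$, let $\bm i,\bm j$ range over $\{0,1\}^n$, and let $\lambda_{\bm i,\bm j}\ge 0$ be real numbers with $\sum_{\bm i,\bm j}\lambda_{\bm i,\bm j}=1$; put $\lambda_{\bm i}:=\sum_{\bm j}\lambda_{\bm i,\bm j}$. Let $\sigma_{0,0}=I$, $\sigma_{1,0}=\sigma_x$, $\sigma_{0,1}=\sigma_z$, $\sigma_{1,1}=\sigma_y$, let $U_{\bm i,\bm j}=\bigotimes_{k=1}^n\sigma_{\bm i_k,\bm j_k}$ and $$|\Phi_{\bm i,\bm j}\rangle=(I_A^{\otimes n}\otimes U_{\bm i,\bm j})\Big(\tfrac{|00\rangle+|11\rangle}{\sqrt2}\Big)^{\otimes n}.$$ Let $E$ be a finite-dimensional quantum system, $\{|e_{\bm i,\bm j}\rangle\}$ an orthonormal family in it, and $$|\Psi\rangle_{ABE}=\sum_{\bm i,\bm j}\sqrt{\lambda_{\bm i,\bm j}}\,|\Phi_{\bm i,\bm j}\rangle\otimes|e_{\bm i,\bm j}\rangle,$$ a purification of the Bell-diagonal state $\sum_{\bm i,\bm j}\lambda_{\bm i,\bm j}|\Phi_{\bm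 i,\bm j}\rangle\langle\Phi_{\bm i,\bm j}|$. Let $\rho^n_{\bm XE}$ be the classical-quantum state obtained when Alice measures all her $n$ qubits in the $\mathbb X$ basis $\{(|0\rangle\pm|1\rangle)/\sqrt2\}$, recording the outcome string $\bm X\in\{0,1\}^n$, and Bob's system is traced out. Let $0\le\hat e_z\le\frac12$, let $\varepsilon\ge 0$, and let $\mathcal S_{\hat e_z}=\{\bm i:\frac1n\sum_k\bm i_k\le\hat e_z\}$. Suppose that $\sum_{\bm i\in\mathcal S_{\hat e_z}}\lambda_{\bm i}=1-\varepsilon^2$. Then $$H_{\min}^{\varepsilon}(\bm X|E)_{\rho^n_{\bm XE}}\ \ge\ n\,[1-h(\hat e_z)],$$ where $h(x)=-x\log_2x-(1-x)\log_2(1-x)$ (with $0\log_2 0=0$). Here $$H_{\min}(A|B)_{\bar\rho}=\sup\{\lambda\in\mathbb R:\ 2^{-\lambda}I_A\otimes\sigma_B\ge\bar\rho_{AB}\text{ for some normalized state }\sigma_B\},$$ and $H_{\min}^{\varepsilon}(A|B)_\rho=\sup_{\bar\rho}H_{\min}(A|B)_{\bar\rho}$, the supremum being over all sub-normalized states $\bar\rho$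 ($\bar\rho\ge0$, $0<\operatorname{Tr}\bar\rho\le1$) with $\sqrt{1-F(\rho,\bar\rho)^2}\le\varepsilon$, where $F(\rho,\bar\rho)=\operatorname{Tr}\sqrt{\sqrt\rho\,\bar\rho\sqrt\rho}$. The suprema are taken in the extended reals. -/

import Mathlib

open scoped Matrix Kronecker ComplexOrder MatrixOrder

noncomputable section

/-! ### Conditional min-entropy and its smooth version -/

/-- `ρ` is a sub-normalized state: a nonzero positive semidefinite matrix of trace at most one. -/
def IsSubnormalizedState {m : Type*} [Fintype m] (ρ : Matrix m m ℂ) : Prop :=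
  ρ.PosSemidef ∧ 0 < ρ.trace.re ∧ ρ.trace.re ≤ 1

/-- `σ` is a (normalized) state, i.e. a density matrix. -/
def IsState {m : Type*} [Fintype m] (σ : Matrix m m ℂ) : Prop :=
  σ.PosSemidef ∧ σ.trace = 1

/-- The fidelity `F(ρ, σ) = Tr √(√ρ σ √ρ)` of two positive semidefinite matrices. -/
def fidelity {m : Type*} [Fintype m] [DecidableEq m] (ρ σ : Matrix m m ℂ) : ℝ :=
  (CFC.sqrt (CFC.sqrt ρ * σ * CFC.sqrt ρ)).trace.re

/-- The min-entropy `H_min(A|B)_ρ`: the supremum of all real `l` such that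
`2^{-l} I_A ⊗ σ_B ≥ ρ_AB` for some normalized state `σ_B` of `B`. The supremum is taken in the
extended reals. -/
def minEntropy {a b : Type*} [Fintype a] [DecidableEq a] [Fintype b]
    (ρ : Matrix (a × b) (a × b) ℂ) : EReal :=
  sSup {t : EReal | ∃ (l : ℝ) (σ : Matrix b b ℂ), t = (l : EReal) ∧ IsState σ ∧
    ((((2 : ℝ) ^ (-l) : ℝ) : ℂ) • ((1 : Matrix a a ℂ) ⊗ₖ σ) - ρ).PosSemidef}

/-- The ball `B_ε(ρ)` of all sub-normalized states that are `ε`-close to `ρ`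
in purified distance. -/
def smoothingBall {m : Type*} [Fintype m] [DecidableEq m] (ε : ℝ) (ρ : Matrix m m ℂ) :
    Set (Matrix m m ℂ) :=
  {ρ' | IsSubnormalizedState ρ' ∧ Real.sqrt (1 - fidelity ρ ρ' ^ 2) ≤ ε}

/-- The smooth min-entropy `H_min^ε(A|B)_ρ`. -/
def smoothMinEntropy {a b : Type*} [Fintype a] [DecidableEq a] [Fintype b] [DecidableEq b]
    (ε : ℝ) (ρ : Matrix (a × b) (a × b) ℂ) : EReal :=
  ⨆ ρ' ∈ smoothingBall ε ρ, minEntropy ρ'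

/-- The binary entropy function (base two); it vanishes at `0` and `1`. -/
def binEntropyTwo (x : ℝ) : ℝ := -x * Real.logb 2 x - (1 - x) * Real.logb 2 (1 - x)

/-! ### The purified Bell-diagonal state and Alice's `X`-basis measurement -/

/-- Bit strings of length `n`; they also label the computational basis of `n` qubits. -/
abbrev Bits (n : ℕ) : Type := Fin n → Fin 2

/-- The matrices `I`, `σ_x`, `σ_z`, `σ_y` for `(i, j) = (0,0)`, `(1,0)`, `(0,1)`, `(1,1)`:
the bit `i` flips the `Z` basis and the bit `j` flips the `X` basis. -/
def pauli (i j : Fin 2) : Matrix (Fin 2) (Fin 2) ℂ :=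
  match i, j with
  | 0, 0 => 1
  | 1, 0 => !![0, 1; 1, 0]
  | 0, 1 => !![1, 0; 0, -1]
  | 1, 1 => !![0, -Complex.I; Complex.I, 0]

/-- The tensor product `U_{i,j}` of the single-qubit Pauli matrices. -/
def pauliString {n : ℕ} (i j : Bits n) : Matrix (Bits n) (Bits n) ℂ :=
  Matrix.of fun a b => ∏ k, pauli (i k) (j k) (a k) (b k)

/-- The vector `((|00⟩ + |11⟩)/√2)^{⊗ n}` of Alice's and Bob's `n` qubits each. -/
def maxEntangled (n : ℕ) : Bits n × Bits n → ℂ :=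
  fun ab => ∏ k, if ab.1 k = ab.2 k then ((1 / Real.sqrt 2 : ℝ) : ℂ) else 0

/-- The `n`-pair Bell state `|Φ_{i,j}⟩ = (I_A ⊗ U_{i,j}) ((|00⟩ + |11⟩)/√2)^{⊗ n}`. -/
def bellState {n : ℕ} (i j : Bits n) : Bits n × Bits n → ℂ :=
  ((1 : Matrix (Bits n) (Bits n) ℂ) ⊗ₖ pauliString i j) *ᵥ maxEntangled n

/-- The purification `|Ψ⟩_ABE = ∑_{i,j} √λ_{i,j} |Φ_{i,j}⟩ ⊗ |e_{i,j}⟩` of the Bell-diagonal state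
`∑_{i,j} λ_{i,j} |Φ_{i,j}⟩⟨Φ_{i,j}|`. -/
def psiABE {n : ℕ} {κ : Type*} [Fintype κ] (lam : Bits n → Bits n → ℝ)
    (e : Bits n × Bits n → EuclideanSpace ℂ κ) : (Bits n × Bits n) × κ → ℂ :=
  fun v => ∑ i, ∑ j, ((Real.sqrt (lam i j) : ℝ) : ℂ) * bellState i j v.1 * e (i, j) v.2

/-- The `X`-basis vector of `n` qubits labelled by `x`: the tensor product of the vectors
`(|0⟩ + (-1)^{x_k} |1⟩)/√2`. -/
def xBasis {n : ℕ} (x : Bits n) : Bits n → ℂ :=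
  fun a => ∏ k, ((1 / Real.sqrt 2 : ℝ) : ℂ) * (-1) ^ ((x k : ℕ) * (a k : ℕ))

/-- The classical-quantum state obtained from a state of `ABE` when Alice measures all her qubits
in the `X` basis, records the outcome `x`, and Bob's system is traced out:
`∑_x |x⟩⟨x| ⊗ Tr_AB[(|x̃⟩⟨x̃|_A ⊗ I_BE) ρ]`, with `|x̃⟩ = xBasis x`. -/
def measureAliceX {n : ℕ} {κ : Type*}
    (ρ : Matrix ((Bits n × Bits n) × κ) ((Bits n × Bits n) × κ) ℂ) :
    Matrix (Bits n × κ) (Bits n × κ) ℂ :=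
  Matrix.of fun u v => if u.1 = v.1 then
    ∑ a, ∑ a', ∑ b, star (xBasis u.1 a) * ρ ((a, b), u.2) ((a', b), v.2) * xBasis u.1 a'
  else 0

/-- The state `ρ_XE` of Alice's `X`-basis outcomes and Eve's system. -/
def rhoXE {n : ℕ} {κ : Type*} [Fintype κ] (lam : Bits n → Bits n → ℝ)
    (e : Bits n × Bits n → EuclideanSpace ℂ κ) : Matrix (Bits n × κ) (Bits n × κ) ℂ :=
  measureAliceX (Matrix.vecMulVec (psiABE lam e) (star (psiABE lam e)))

/-- The marginal `λ_i = ∑_j λ_{i,j}`. -/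
def marginal {n : ℕ} (lam : Bits n → Bits n → ℝ) (i : Bits n) : ℝ := ∑ j, lam i j

open Classical in
/-- The set of error patterns `i` whose relative weight is at most `q`. -/
def lowWeight (n : ℕ) (q : ℝ) : Finset (Bits n) :=
  Finset.univ.filter fun i => (∑ k, ((i k : ℕ) : ℝ)) / (n : ℝ) ≤ q

end

/-! In the `X` basis, Alice's outcome `x` on `|Φ_{i,j}⟩` leaves Bob, up to phase, in the basis
vector `x + j`. Tracing Bob out therefore decoheres `j` but leaves the superposition over `i`
intact: `ρ_XE` is a sum over `(x, j)` of rank-one terms, each built from `|x⟩` and a superposition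
of the `|e_{i,j}⟩` with weights `√λ_{i,j}` and amplitudes of modulus `2^{-n/2}`
(`rhoXE_eq_sum_vecMulVec`).

If `λ` is supported on `i ∈ S`, each superposition has at most `|S|` terms, and pinching gives `ρ_XE
≤ |S| 2^{-n} I ⊗ ρ_E` (`posSemidef_smul_one_kronecker_eveState_sub_rhoXE`). For strings of relative
weight at most `q`, `|S| ≤ 2^{n h(q)}` (`card_lowWeight_le`), which is the entropy bound.

For general `λ`, smooth to the state whose weights are `λ` conditioned on `S`. The rank-one terms of
the two states are biorthogonal, so their fidelity is the classical `∑ √(λ μ) = √(1 - ε²)`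
(`fidelity_rhoXE`), and the purified distance is exactly `ε`. -/

/-! ### Square roots, fidelity and pinching for sums of rank-one matrices -/

open Matrix in
/-- The square root of `∑ a, v a (v a)ᴴ` for an orthogonal family `v` with norms `r`. -/
theorem sqrt_sum_vecMulVec_of_orthogonal {ι m : Type*} [Fintype ι] [DecidableEq ι] [Fintype m]
    [DecidableEq m] (v : ι → m → ℂ) (r : ι → ℝ) (hr : ∀ a, 0 ≤ r a)
    (hv : ∀ a b, star (v a) ⬝ᵥ v b = if a = b then ((r a : ℂ)) ^ 2 else 0) :
    CFC.sqrt (∑ a, vecMulVec (v a) (star (v a))) =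
      ∑ a, ((r a : ℂ))⁻¹ • vecMulVec (v a) (star (v a)) := by
  refine CFC.sqrt_unique ?_ ?_
  · rw [Finset.sum_mul_sum]
    refine Finset.sum_congr rfl fun a _ => ?_
    rw [Finset.sum_eq_single a]
    -- The convention `0⁻¹ = 0` is harmless here, since a vector of norm zero vanishes.
    · by_cases h : r a = 0
      · have : v a = 0 := by
          have := hv a a
          simp only [h, if_true] at this
          exact dotProduct_star_self_eq_zero.mp (by rw [dotProduct_comm]; simpa using this)
        simp [this]
      · have h' : (r a : ℂ) ≠ 0 := by exact_mod_cast h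
        rw [smul_mul_assoc, mul_smul_comm, vecMulVec_mul_vecMulVec, hv, if_pos rfl,
          vecMulVec_smul, smul_smul, smul_smul]
        field_simp
        simp
    · intro b _ hb
      rw [smul_mul_assoc, mul_smul_comm, vecMulVec_mul_vecMulVec, hv, if_neg hb.symm]
      simp
    · simp
  · rw [nonneg_iff_posSemidef]
    refine posSemidef_sum _ fun a _ => (posSemidef_vecMulVec_self_star _).smul ?_
    rw [← Complex.ofReal_inv]
    exact_mod_cast inv_nonneg.mpr (hr a)

open Matrix in
/-- The fidelity of `∑ a, v a (v a)ᴴ` and `∑ a, w a (w a)ᴴ` for biorthogonal families whose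
diagonal overlaps `s` are nonnegative. -/
theorem fidelity_sum_vecMulVec_of_biorthogonal {ι m : Type*} [Fintype ι] [DecidableEq ι]
    [Fintype m] [DecidableEq m] (v w : ι → m → ℂ) (r s : ι → ℝ) (hr : ∀ a, 0 ≤ r a)
    (hs : ∀ a, 0 ≤ s a)
    (hv : ∀ a b, star (v a) ⬝ᵥ v b = if a = b then ((r a : ℂ)) ^ 2 else 0)
    (hw : ∀ a b, star (v a) ⬝ᵥ w b = if a = b then ((s a : ℂ)) else 0) :
    fidelity (∑ a, vecMulVec (v a) (star (v a))) (∑ a, vecMulVec (w a) (star (w a))) =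
      ∑ a, s a := by
  have hrs : ∀ a, r a = 0 → s a = 0 := fun a h => by
    have h0 : v a = 0 := by
      have := hv a a
      simp only [h, if_true] at this
      exact dotProduct_star_self_eq_zero.mp (by rw [dotProduct_comm]; simpa using this)
    have := hw a a
    simp [h0] at this
    exact_mod_cast this.symm
  -- These are the images of the `w a` under the square root of the first matrix. They are
  -- orthogonal with norms `s a`, so the square-root formula applies a second time.
  set u : ι → m → ℂ := fun a => ((s a / r a : ℝ) : ℂ) • v a with hu
  have hu' : ∀ a b, star (u a) ⬝ᵥ u b = if a = b then ((s a : ℂ)) ^ 2 else 0 := by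
    intro a b
    simp only [hu, star_smul, smul_dotProduct, dotProduct_smul, hv]
    split_ifs with h
    · subst h
      by_cases h : r a = 0
      · simp [hrs a h]
      · have h' : (r a : ℂ) ≠ 0 := by exact_mod_cast h
        simp
        field_simp
    · simp
  set R : Matrix m m ℂ := ∑ a, ((r a : ℂ))⁻¹ • vecMulVec (v a) (star (v a)) with hR
  have hRpos : R.IsHermitian := by
    rw [IsHermitian, hR, conjTranspose_sum]
    refine Finset.sum_congr rfl fun a _ => ?_
    rw [conjTranspose_smul, conjTranspose_vecMulVec]
    simp
  have hRw : ∀ a, R *ᵥ w a = u a := by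
    intro a
    rw [hR, sum_mulVec, Finset.sum_eq_single a]
    · rw [smul_mulVec, vecMulVec_mulVec, hw, if_pos rfl]
      ext k
      simp [hu]
      ring
    · intro b _ hb
      rw [smul_mulVec, vecMulVec_mulVec, hw, if_neg hb]
      simp
    · simp
  clear_value R
  have key : R * (∑ a, vecMulVec (w a) (star (w a))) * R =
      ∑ a, vecMulVec (u a) (star (u a)) := by
    rw [Finset.mul_sum, Finset.sum_mul]
    refine Finset.sum_congr rfl fun a _ => ?_
    rw [mul_vecMulVec, vecMulVec_mul, hRw]
    congr 1
    rw [← hRw a, star_mulVec, hRpos.eq]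
  rw [fidelity, sqrt_sum_vecMulVec_of_orthogonal v r hr hv, ← hR, key,
    sqrt_sum_vecMulVec_of_orthogonal u s hs hu', trace_sum, Complex.re_sum]
  refine Finset.sum_congr rfl fun a _ => ?_
  rw [trace_smul, trace_vecMulVec, dotProduct_comm, hu', if_pos rfl]
  by_cases h : s a = 0
  · simp [h]
  · have h' : (s a : ℂ) ≠ 0 := by exact_mod_cast h
    rw [smul_eq_mul, sq, inv_mul_cancel_left₀ h', Complex.ofReal_re]

open Matrix in
/-- The pinching inequality for a sum of finitely many vectors. -/
theorem posSemidef_card_smul_sum_vecMulVec_sub {ι m : Type*} [Fintype m] (S : Finset ι)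
    (u : ι → m → ℂ) :
    ((S.card : ℂ) • ∑ i ∈ S, vecMulVec (u i) (star (u i)) -
      vecMulVec (∑ i ∈ S, u i) (star (∑ i ∈ S, u i))).PosSemidef := by
  -- The difference is a variance: half the sum of the projectors onto all pairwise differences `u i
  -- - u j`.
  have h : (S.card : ℂ) • ∑ i ∈ S, vecMulVec (u i) (star (u i)) -
      vecMulVec (∑ i ∈ S, u i) (star (∑ i ∈ S, u i)) =
      (1 / 2 : ℂ) • ∑ i ∈ S, ∑ j ∈ S, vecMulVec (u i - u j) (star (u i - u j)) := by
    ext a b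
    simp only [Matrix.sub_apply, Matrix.smul_apply, Matrix.sum_apply, vecMulVec_apply, Pi.star_apply,
      Finset.sum_apply, star_sum, Pi.sub_apply, star_sub, sub_mul, mul_sub,
      Finset.sum_sub_distrib, Finset.sum_const, nsmul_eq_mul, smul_eq_mul,
      ← Finset.mul_sum, ← Finset.sum_mul]
    ring
  rw [h]
  refine PosSemidef.smul (posSemidef_sum _ fun i _ => posSemidef_sum _ fun j _ =>
    posSemidef_vecMulVec_self_star _) ?_
  rw [show (1 / 2 : ℂ) = ((1 / 2 : ℝ) : ℂ) by norm_num]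
  exact_mod_cast (by norm_num : (0 : ℝ) ≤ 1 / 2)

/-! ### Counting low-weight strings -/

/-- The number of bit strings of relative weight at most `q ≤ 1/2` is at most `2 ^ (n h(q))`. -/
theorem card_lowWeight_le {n : ℕ} (hn : 1 ≤ n) {q : ℝ} (hq0 : 0 ≤ q) (hq : q ≤ 1 / 2) :
    ((lowWeight n q).card : ℝ) ≤ 2 ^ ((n : ℝ) * binEntropyTwo q) := by
  have hn' : (0 : ℝ) < n := by exact_mod_cast hn
  rcases hq0.eq_or_lt with rfl | hq0
  · have : lowWeight n 0 ⊆ {0} := by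
      intro i hi
      simp only [lowWeight, Finset.mem_filter, Finset.mem_univ, true_and] at hi
      rw [div_le_iff₀ hn', zero_mul] at hi
      have h0 := (Finset.sum_eq_zero_iff_of_nonneg (fun k _ => Nat.cast_nonneg _)).mp
        (le_antisymm hi (Finset.sum_nonneg fun k _ => Nat.cast_nonneg ((i k : ℕ))))
      rw [Finset.mem_singleton]
      ext k
      simpa using h0 k (Finset.mem_univ k)
    have h1 : (lowWeight n 0).card ≤ 1 := (Finset.card_le_card this).trans (by simp)
    simpa [binEntropyTwo] using h1
  · have hq1 : 0 < 1 - q := by linarith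
    -- Under independent Bernoulli(`q`) bits the total mass is one, while each low-weight string has
    -- probability at least `2^{-n h(q)}`.
    set f : Fin 2 → ℝ := fun b => if b = 0 then 1 - q else q with hf
    have htot : ∑ i : Bits n, ∏ k, f (i k) = 1 := by
      rw [← Fintype.prod_sum (fun (_ : Fin n) b => f b)]
      simp [hf]
    have hf' : ∀ b : Fin 2, f b = (1 - q) * 2 ^ ((b : ℕ) * (Real.logb 2 q - Real.logb 2 (1 - q))) := by
      intro b
      fin_cases b
      · simp [hf]
      · simp only [hf, Fin.mk_one, one_ne_zero, if_false, Nat.cast_one, one_mul]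
        rw [Real.rpow_sub two_pos, Real.rpow_logb two_pos (by norm_num) hq0,
          Real.rpow_logb two_pos (by norm_num) hq1]
        field_simp
    have hlow : ∀ i ∈ lowWeight n q, (2 : ℝ) ^ (-((n : ℝ) * binEntropyTwo q)) ≤ ∏ k, f (i k) := by
      intro i hi
      simp only [lowWeight, Finset.mem_filter, Finset.mem_univ, true_and] at hi
      rw [div_le_iff₀ hn'] at hi
      simp only [hf']
      rw [Finset.prod_mul_distrib, ← Real.rpow_sum_of_pos two_pos, ← Finset.sum_mul]
      rw [Finset.prod_const, Finset.card_univ, Fintype.card_fin]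
      have h1 : (1 - q) ^ n = (2 : ℝ) ^ ((n : ℝ) * Real.logb 2 (1 - q)) := by
        rw [mul_comm, Real.rpow_mul two_pos.le, Real.rpow_logb two_pos (by norm_num) hq1,
          Real.rpow_natCast]
      rw [h1, ← Real.rpow_add two_pos]
      refine Real.rpow_le_rpow_of_exponent_le one_le_two ?_
      -- As `q ≤ 1/2`, the probability of a string does not increase with its weight, so weight `n
      -- q` is the worst case.
      have hlog : Real.logb 2 q ≤ Real.logb 2 (1 - q) :=
        Real.logb_le_logb_of_le one_lt_two hq0 (by linarith)
      have := mul_le_mul_of_nonneg_right hi (sub_nonneg.mpr hlog)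
      rw [binEntropyTwo]
      nlinarith
    have := (Finset.card_nsmul_le_sum _ _ _ hlow).trans
      ((Finset.sum_le_univ_sum_of_nonneg fun i => Finset.prod_nonneg fun k _ => by
        simp only [hf]; split_ifs <;> linarith).trans_eq htot)
    rw [nsmul_eq_mul, Real.rpow_neg two_pos.le, ← div_eq_mul_inv,
      div_le_one (Real.rpow_pos_of_pos two_pos _)] at this
    exact this

/-! ### Bell states in the `X` basis -/

/-- The phase picked up by the `X`-basis vector `x` of one qubit under `pauli i j`. -/
def pauliPhase (i j x : Fin 2) : ℂ :=
  if i = 0 then 1 else if j = 0 then (-1) ^ (x : ℕ) else Complex.I * (-1) ^ ((x : ℕ) + 1)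

theorem star_pauliPhase_mul_self (i j x : Fin 2) :
    star (pauliPhase i j x) * pauliPhase i j x = 1 := by
  fin_cases i <;> fin_cases j <;> fin_cases x <;> simp [pauliPhase]

/-- `pauli i j` maps the `X`-basis vector `x` to a multiple of the `X`-basis vector `x + j`. -/
theorem sum_pauli_mul_neg_one_pow (i j x b : Fin 2) :
    ∑ a : Fin 2, (-1 : ℂ) ^ ((x : ℕ) * (a : ℕ)) * pauli i j b a =
      pauliPhase i j x * (-1) ^ (((x + j : Fin 2) : ℕ) * (b : ℕ)) := by
  fin_cases i <;> fin_cases j <;> fin_cases x <;> fin_cases b <;>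
    simp [pauliPhase, pauli, Matrix.one_apply]

/-- The amplitude with which measuring `x` on Alice's side of `bellState i j` leaves Bob with the
`X`-basis vector `x + j`. -/
noncomputable def bellAmplitude {n : ℕ} (i j x : Bits n) : ℂ :=
  ∏ k, ((1 / Real.sqrt 2 : ℝ) : ℂ) * pauliPhase (i k) (j k) (x k)

theorem ofReal_one_div_sqrt_two_mul_self :
    ((1 / Real.sqrt 2 : ℝ) : ℂ) * ((1 / Real.sqrt 2 : ℝ) : ℂ) = 1 / 2 := by
  rw [← Complex.ofReal_mul, div_mul_div_comm, Real.mul_self_sqrt zero_le_two]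
  norm_num

/-- Pauli phases have modulus one, so Alice's outcome is uniform for every error pattern; this is
the source of the factor `2^{-n}`. -/
theorem star_bellAmplitude_mul_self {n : ℕ} (i j x : Bits n) :
    star (bellAmplitude i j x) * bellAmplitude i j x = (1 / 2) ^ n := by
  rw [bellAmplitude, star_prod, ← Finset.prod_mul_distrib]
  refine (Finset.prod_eq_pow_card (b := 1 / 2) fun k _ => ?_).trans (by simp)
  rw [star_mul', mul_mul_mul_comm, star_pauliPhase_mul_self, Complex.star_def,
    Complex.conj_ofReal, ofReal_one_div_sqrt_two_mul_self, mul_one]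

theorem bellState_apply {n : ℕ} (i j a b : Bits n) :
    bellState i j (a, b) = ∏ k, pauli (i k) (j k) (b k) (a k) * ((1 / Real.sqrt 2 : ℝ) : ℂ) := by
  have hmax : ∀ a b : Bits n, maxEntangled n (a, b) =
      if a = b then ∏ _k : Fin n, ((1 / Real.sqrt 2 : ℝ) : ℂ) else 0 := by
    intro a b
    rw [maxEntangled, Finset.prod_ite_zero]
    simp [funext_iff]
  rw [bellState, Matrix.mulVec, dotProduct, Fintype.sum_prod_type, Finset.sum_eq_single a,
    Finset.sum_eq_single a, hmax, if_pos rfl, Matrix.kroneckerMap_apply, Matrix.one_apply_eq,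
    one_mul, pauliString, Matrix.of_apply, ← Finset.prod_mul_distrib]
  · intro b' _ hb'
    rw [hmax, if_neg hb'.symm, mul_zero]
  · simp
  · intro a' _ ha'
    simp [Matrix.kroneckerMap_apply, Matrix.one_apply_ne ha'.symm]
  · simp

/-- All factors are products over qubits, which reduces the claim to `sum_pauli_mul_neg_one_pow`. -/
theorem sum_star_xBasis_mul_bellState {n : ℕ} (i j x b : Bits n) :
    ∑ a, star (xBasis x a) * bellState i j (a, b) = bellAmplitude i j x * xBasis (x + j) b := by
  simp only [bellState_apply, xBasis, star_prod, ← Finset.prod_mul_distrib, bellAmplitude]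
  rw [← Fintype.prod_sum (fun (k : Fin n) (a : Fin 2) =>
    star (((1 / Real.sqrt 2 : ℝ) : ℂ) * (-1) ^ ((x k : ℕ) * (a : ℕ))) *
      (pauli (i k) (j k) (b k) a * ((1 / Real.sqrt 2 : ℝ) : ℂ)))]
  refine Finset.prod_congr rfl fun k _ => ?_
  have h := sum_pauli_mul_neg_one_pow (i k) (j k) (x k) (b k)
  rw [Pi.add_apply, mul_assoc, mul_left_comm (pauliPhase _ _ _), ← h, ← mul_assoc,
    Finset.mul_sum]
  refine Finset.sum_congr rfl fun a _ => ?_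
  rw [star_mul', Complex.star_def, Complex.conj_ofReal, map_pow, map_neg, map_one]
  ring

theorem sum_xBasis_mul_star_xBasis {n : ℕ} (y y' : Bits n) :
    ∑ b, xBasis y b * star (xBasis y' b) = if y = y' then 1 else 0 := by
  simp only [xBasis, star_prod, ← Finset.prod_mul_distrib]
  rw [← Fintype.prod_sum (fun (k : Fin n) (b : Fin 2) =>
    ((1 / Real.sqrt 2 : ℝ) : ℂ) * (-1) ^ ((y k : ℕ) * (b : ℕ)) *
    star (((1 / Real.sqrt 2 : ℝ) : ℂ) * (-1) ^ ((y' k : ℕ) * (b : ℕ))))]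
  have h : ∀ z z' : Fin 2, ∑ b : Fin 2, ((1 / Real.sqrt 2 : ℝ) : ℂ) * (-1) ^ ((z : ℕ) * (b : ℕ)) *
      star (((1 / Real.sqrt 2 : ℝ) : ℂ) * (-1) ^ ((z' : ℕ) * (b : ℕ))) =
      if z = z' then 1 else 0 := by
    intro z z'
    simp only [star_mul', Complex.star_def, Complex.conj_ofReal, mul_mul_mul_comm _ _ (Complex.ofReal _),
      ofReal_one_div_sqrt_two_mul_self]
    fin_cases z <;> fin_cases z' <;> norm_num
  simp only [h]
  rw [Finset.prod_ite_zero]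
  simp [funext_iff]

/-! ### Rank-one decomposition of `ρ_XE` and its fidelities -/

/-- The unnormalized post-measurement vector of `XE` for Alice's outcome `x` when Bob's `X`-basis
outcome is `x + j`. -/
noncomputable def vecXE {n : ℕ} {κ : Type*} [Fintype κ] (lam : Bits n → Bits n → ℝ)
    (e : Bits n × Bits n → EuclideanSpace ℂ κ) (p : Bits n × Bits n) : Bits n × κ → ℂ :=
  fun u => if u.1 = p.1 then
    ∑ i, ((Real.sqrt (lam i p.2) : ℝ) : ℂ) * bellAmplitude i p.2 p.1 * e (i, p.2) u.2 else 0

theorem sum_star_xBasis_mul_psiABE {n : ℕ} {κ : Type*} [Fintype κ] (lam : Bits n → Bits n → ℝ)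
    (e : Bits n × Bits n → EuclideanSpace ℂ κ) (x b : Bits n) (k : κ) :
    ∑ a, star (xBasis x a) * psiABE lam e ((a, b), k) =
      ∑ j, vecXE lam e (x, j) (x, k) * xBasis (x + j) b := by
  calc _ = ∑ a, ∑ j, ∑ i, ((Real.sqrt (lam i j) : ℝ) : ℂ) * e (i, j) k *
        (star (xBasis x a) * bellState i j (a, b)) := by
        refine Finset.sum_congr rfl fun a _ => ?_
        rw [psiABE, Finset.sum_comm, Finset.mul_sum]
        refine Finset.sum_congr rfl fun j _ => ?_
        rw [Finset.mul_sum]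
        exact Finset.sum_congr rfl fun i _ => by ring
    _ = ∑ j, ∑ i, ((Real.sqrt (lam i j) : ℝ) : ℂ) * e (i, j) k *
        ∑ a, star (xBasis x a) * bellState i j (a, b) := by
        rw [Finset.sum_comm]
        refine Finset.sum_congr rfl fun j _ => ?_
        rw [Finset.sum_comm]
        exact Finset.sum_congr rfl fun i _ => (Finset.mul_sum _ _ _).symm
    _ = _ := by
        refine Finset.sum_congr rfl fun j _ => ?_
        rw [vecXE, if_pos rfl, Finset.sum_mul]
        refine Finset.sum_congr rfl fun i _ => ?_
        rw [sum_star_xBasis_mul_bellState]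
        ring

/-- Orthonormality of Bob's vectors `x + j` removes the cross terms `j ≠ j'` when Bob is traced out.
-/
theorem rhoXE_eq_sum_vecMulVec {n : ℕ} {κ : Type*} [Fintype κ] (lam : Bits n → Bits n → ℝ)
    (e : Bits n × Bits n → EuclideanSpace ℂ κ) :
    rhoXE lam e = ∑ p, Matrix.vecMulVec (vecXE lam e p) (star (vecXE lam e p)) := by
  ext ⟨x, k⟩ ⟨x', k'⟩
  rw [rhoXE, measureAliceX, Matrix.of_apply, Matrix.sum_apply, Fintype.sum_prod_type]
  dsimp only
  split_ifs with h
  · subst h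
    have h1 : ∀ b, (∑ a, ∑ a', star (xBasis x a) * (Matrix.vecMulVec (psiABE lam e)
        (star (psiABE lam e)) ((a, b), k) ((a', b), k')) * xBasis x a') =
        (∑ j, vecXE lam e (x, j) (x, k) * xBasis (x + j) b) *
          star (∑ j, vecXE lam e (x, j) (x, k') * xBasis (x + j) b) := by
      intro b
      rw [← sum_star_xBasis_mul_psiABE, ← sum_star_xBasis_mul_psiABE, star_sum,
        Finset.sum_mul_sum]
      refine Finset.sum_congr rfl fun a _ => Finset.sum_congr rfl fun a' _ => ?_
      rw [Matrix.vecMulVec_apply, star_mul', star_star, Pi.star_apply]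
      ring
    calc _ = ∑ b, ∑ a, ∑ a', star (xBasis x a) * (Matrix.vecMulVec (psiABE lam e)
        (star (psiABE lam e)) ((a, b), k) ((a', b), k')) * xBasis x a' := by
          rw [Finset.sum_comm (s := (Finset.univ : Finset (Bits n)))
            (f := fun b a => ∑ a', star (xBasis x a) * (Matrix.vecMulVec (psiABE lam e)
              (star (psiABE lam e)) ((a, b), k) ((a', b), k')) * xBasis x a')]
          exact Finset.sum_congr rfl fun a _ => Finset.sum_comm
      _ = ∑ b, ∑ j, ∑ j', vecXE lam e (x, j) (x, k) * star (vecXE lam e (x, j') (x, k')) *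
          (xBasis (x + j) b * star (xBasis (x + j') b)) := by
          refine Finset.sum_congr rfl fun b _ => ?_
          rw [h1, star_sum, Finset.sum_mul_sum]
          refine Finset.sum_congr rfl fun j _ => Finset.sum_congr rfl fun j' _ => ?_
          rw [star_mul']
          ring
      _ = ∑ j, ∑ j', vecXE lam e (x, j) (x, k) * star (vecXE lam e (x, j') (x, k')) *
          ∑ b, xBasis (x + j) b * star (xBasis (x + j') b) := by
          rw [Finset.sum_comm]
          refine Finset.sum_congr rfl fun j _ => ?_
          rw [Finset.sum_comm]
          refine Finset.sum_congr rfl fun j' _ => ?_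
          rw [Finset.mul_sum]
      _ = ∑ j, vecXE lam e (x, j) (x, k) * star (vecXE lam e (x, j) (x, k')) := by
          simp only [sum_xBasis_mul_star_xBasis, add_right_inj, mul_ite, mul_one, mul_zero,
            Finset.sum_ite_eq, Finset.mem_univ, if_true]
      _ = ∑ y, ∑ j, Matrix.vecMulVec (vecXE lam e (y, j)) (star (vecXE lam e (y, j)))
          (x, k) (x, k') := by
          symm
          refine Finset.sum_eq_single x (fun y _ hy => Finset.sum_eq_zero fun j _ => ?_) (by simp)
          rw [Matrix.vecMulVec_apply, vecXE]
          dsimp only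
          rw [if_neg hy.symm, zero_mul]
  · refine (Finset.sum_eq_zero fun y _ => Finset.sum_eq_zero fun j _ => ?_).symm
    rw [Matrix.vecMulVec_apply, Pi.star_apply, vecXE, vecXE]
    dsimp only
    by_cases hx : x = y
    · rw [if_neg (fun h' => h (hx.trans h'.symm) : ¬ x' = y), star_zero, mul_zero]
    · rw [if_neg hx, zero_mul]

/-- Two weights are allowed so that one formula covers both the norms (`mu = lam`) and the overlaps
needed for the fidelity. -/
theorem star_vecXE_dotProduct_vecXE {n : ℕ} {κ : Type*} [Fintype κ]
    (lam mu : Bits n → Bits n → ℝ) {e : Bits n × Bits n → EuclideanSpace ℂ κ}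
    (he : Orthonormal ℂ e) (p r : Bits n × Bits n) :
    star (vecXE lam e p) ⬝ᵥ vecXE mu e r =
      if p = r then ((((1 / 2) ^ n * ∑ i, Real.sqrt (lam i p.2) * Real.sqrt (mu i p.2) : ℝ)) : ℂ)
      else 0 := by
  obtain ⟨x, j⟩ := p
  obtain ⟨y, j'⟩ := r
  have horth : ∀ s t, ∑ k, star (e s k) * e t k = if s = t then 1 else 0 := by
    intro s t
    rw [← orthonormal_iff_ite.mp he s t, EuclideanSpace.inner_eq_star_dotProduct, dotProduct]
    exact Finset.sum_congr rfl fun k _ => mul_comm _ _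
  rw [dotProduct, Fintype.sum_prod_type]
  by_cases hxy : x = y
  · subst hxy
    rw [Finset.sum_eq_single x]
    · simp only [Pi.star_apply, vecXE, if_true, star_sum, Finset.sum_mul_sum]
      calc _ = ∑ i, ∑ i', (star (((Real.sqrt (lam i j) : ℝ) : ℂ) * bellAmplitude i j x) *
            (((Real.sqrt (mu i' j') : ℝ) : ℂ) * bellAmplitude i' j' x)) *
            ∑ k, star (e (i, j) k) * e (i', j') k := by
            rw [Finset.sum_comm]
            refine Finset.sum_congr rfl fun i _ => ?_
            rw [Finset.sum_comm]
            refine Finset.sum_congr rfl fun i' _ => ?_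
            rw [Finset.mul_sum]
            refine Finset.sum_congr rfl fun k _ => ?_
            rw [star_mul' (_ * _)]
            ring
        _ = _ := by
            simp only [horth, Prod.mk.injEq]
            by_cases hj : j = j'
            · subst hj
              simp only [and_true, if_true, mul_ite, mul_one, mul_zero,
                Finset.sum_ite_eq, Finset.mem_univ]
              push_cast
              rw [Finset.mul_sum]
              refine Finset.sum_congr rfl fun i _ => ?_
              rw [← star_bellAmplitude_mul_self i j x, star_mul', Complex.star_def,
                Complex.conj_ofReal]
              ring
            · simp [hj]
    · intro z _ hz
      simp [vecXE, hz]
    · simp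
  · rw [if_neg (by simp [hxy])]
    refine Finset.sum_eq_zero fun z _ => Finset.sum_eq_zero fun k _ => ?_
    simp only [Pi.star_apply, vecXE]
    by_cases hz : z = x
    · rw [if_neg (fun h => hxy (hz.symm.trans h) : ¬ z = y), mul_zero]
    · rw [if_neg hz, star_zero, zero_mul]

theorem posSemidef_rhoXE {n : ℕ} {κ : Type*} [Fintype κ] (lam : Bits n → Bits n → ℝ)
    (e : Bits n × Bits n → EuclideanSpace ℂ κ) : (rhoXE lam e).PosSemidef := by
  rw [rhoXE_eq_sum_vecMulVec]
  exact Matrix.posSemidef_sum _ fun p _ => Matrix.posSemidef_vecMulVec_self_star _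

/-- Summing over Alice's outcomes cancels the normalization `2 ^ (-n)`. -/
theorem sum_half_pow_mul {n : ℕ} (f : Bits n → Bits n → ℝ) :
    ∑ p : Bits n × Bits n, (1 / 2 : ℝ) ^ n * ∑ i, f i p.2 = ∑ i, ∑ j, f i j := by
  rw [Fintype.sum_prod_type]
  dsimp only
  rw [Finset.sum_const, ← Finset.mul_sum, Finset.sum_comm,
    nsmul_eq_mul, ← mul_assoc]
  simp

theorem isSubnormalizedState_rhoXE {n : ℕ} {κ : Type*} [Fintype κ] {lam : Bits n → Bits n → ℝ}
    (hlam : ∀ i j, 0 ≤ lam i j) (hsum : ∑ i, ∑ j, lam i j = 1)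
    {e : Bits n × Bits n → EuclideanSpace ℂ κ} (he : Orthonormal ℂ e) :
    IsSubnormalizedState (rhoXE lam e) := by
  have htr : (rhoXE lam e).trace.re = 1 := by
    rw [rhoXE_eq_sum_vecMulVec, Matrix.trace_sum, Complex.re_sum, ← hsum,
      ← sum_half_pow_mul]
    refine Finset.sum_congr rfl fun p _ => ?_
    rw [Matrix.trace_vecMulVec, dotProduct_comm, star_vecXE_dotProduct_vecXE _ _ he,
      if_pos rfl, Complex.ofReal_re]
    simp only [Real.mul_self_sqrt (hlam _ _)]
  exact ⟨posSemidef_rhoXE lam e, by rw [htr]; exact one_pos, htr.le⟩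

theorem fidelity_rhoXE {n : ℕ} {κ : Type*} [Fintype κ] [DecidableEq κ]
    {lam : Bits n → Bits n → ℝ} (hlam : ∀ i j, 0 ≤ lam i j) (mu : Bits n → Bits n → ℝ)
    {e : Bits n × Bits n → EuclideanSpace ℂ κ} (he : Orthonormal ℂ e) :
    fidelity (rhoXE lam e) (rhoXE mu e) =
      ∑ i, ∑ j, Real.sqrt (lam i j) * Real.sqrt (mu i j) := by
  rw [rhoXE_eq_sum_vecMulVec, rhoXE_eq_sum_vecMulVec, ← sum_half_pow_mul]
  refine fidelity_sum_vecMulVec_of_biorthogonal _ _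
    (fun p => Real.sqrt ((1 / 2 : ℝ) ^ n * ∑ i, lam i p.2)) _ (fun p => Real.sqrt_nonneg _)
    (fun p => by positivity) (fun p r => ?_) (star_vecXE_dotProduct_vecXE lam mu he)
  rw [star_vecXE_dotProduct_vecXE _ _ he]
  simp only [Real.mul_self_sqrt (hlam _ _)]
  rw [← Complex.ofReal_pow, Real.sq_sqrt]
  exact mul_nonneg (by positivity) (Finset.sum_nonneg fun i _ => hlam _ _)

/-! ### Operator bound and min-entropy -/

/-- Eve's state `∑ λ_{i,j} |e_{i,j}⟩⟨e_{i,j}|`. -/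
noncomputable def eveState {n : ℕ} {κ : Type*} [Fintype κ] (lam : Bits n → Bits n → ℝ)
    (e : Bits n × Bits n → EuclideanSpace ℂ κ) : Matrix κ κ ℂ :=
  ∑ i, ∑ j, (lam i j : ℂ) • Matrix.vecMulVec (e (i, j)).ofLp (star (e (i, j)).ofLp)

theorem isState_eveState {n : ℕ} {κ : Type*} [Fintype κ] {lam : Bits n → Bits n → ℝ}
    (hlam : ∀ i j, 0 ≤ lam i j) (hsum : ∑ i, ∑ j, lam i j = 1)
    {e : Bits n × Bits n → EuclideanSpace ℂ κ} (he : Orthonormal ℂ e) :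
    IsState (eveState lam e) := by
  constructor
  · refine Matrix.posSemidef_sum _ fun i _ => Matrix.posSemidef_sum _ fun j _ =>
      (Matrix.posSemidef_vecMulVec_self_star _).smul ?_
    exact_mod_cast hlam i j
  · simp only [eveState, Matrix.trace_sum, Matrix.trace_smul, Matrix.trace_vecMulVec,
      ← EuclideanSpace.inner_eq_star_dotProduct, orthonormal_iff_ite.mp he, if_true, smul_eq_mul,
      mul_one]
    exact_mod_cast hsum

/-- Pinching each superposition over `i ∈ S` costs a factor `|S|`; the pinched terms, summed over
`x`, `j` and `i`, give exactly `2^{-n} I ⊗ ρ_E`. -/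
theorem posSemidef_smul_one_kronecker_eveState_sub_rhoXE {n : ℕ} {κ : Type*} [Fintype κ]
    {lam : Bits n → Bits n → ℝ} (hlam : ∀ i j, 0 ≤ lam i j)
    (e : Bits n × Bits n → EuclideanSpace ℂ κ) (S : Finset (Bits n))
    (hS : ∀ i ∉ S, ∀ j, lam i j = 0) :
    (((S.card : ℂ) * (1 / 2) ^ n) • ((1 : Matrix (Bits n) (Bits n) ℂ) ⊗ₖ eveState lam e) -
      rhoXE lam e).PosSemidef := by
  set u : Bits n × Bits n → Bits n → Bits n × κ → ℂ := fun p i v =>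
    if v.1 = p.1 then
      ((Real.sqrt (lam i p.2) : ℝ) : ℂ) * bellAmplitude i p.2 p.1 * e (i, p.2) v.2 else 0 with hu
  have hvec : ∀ p, vecXE lam e p = ∑ i ∈ S, u p i := by
    intro p
    ext v
    rw [vecXE, Finset.sum_apply]
    simp only [hu]
    split_ifs
    · refine (Finset.sum_subset (Finset.subset_univ S) fun i _ hi => ?_).symm
      simp [hS i hi]
    · simp
  have hsum : ((1 / 2 : ℂ) ^ n) • ((1 : Matrix (Bits n) (Bits n) ℂ) ⊗ₖ eveState lam e) =
      ∑ p, ∑ i ∈ S, Matrix.vecMulVec (u p i) (star (u p i)) := by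
    have hentry : ∀ x x' y j i k k',
        Matrix.vecMulVec (u (y, j) i) (star (u (y, j) i)) (x, k) (x', k') =
        if x = y then if x' = y then
          (1 / 2) ^ n * (lam i j * (e (i, j) k * star (e (i, j) k'))) else 0 else 0 := by
      intro x x' y j i k k'
      rw [Matrix.vecMulVec_apply, Pi.star_apply]
      simp only [hu]
      split_ifs
      · rw [← star_bellAmplitude_mul_self i j y, star_mul', star_mul', Complex.star_def,
          Complex.conj_ofReal]
        conv_rhs => rw [← Real.mul_self_sqrt (hlam i j), Complex.ofReal_mul]
        ring
      all_goals simp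
    ext ⟨x, k⟩ ⟨x', k'⟩
    simp only [Matrix.sum_apply, Fintype.sum_prod_type, hentry, Finset.sum_ite_irrel,
      Finset.sum_const_zero, Finset.sum_ite_eq, Finset.mem_univ, if_true, Matrix.smul_apply,
      Matrix.kroneckerMap_apply, Matrix.one_apply, smul_eq_mul, eveState, Matrix.vecMulVec_apply,
      Pi.star_apply]
    by_cases hx : x = x'
    · subst hx
      simp only [if_true, one_mul, Finset.mul_sum]
      rw [Finset.sum_comm (s := (Finset.univ : Finset (Bits n))) (t := S)]
      refine (Finset.sum_subset (Finset.subset_univ S) fun i _ hi => ?_).symm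
      simp [hS i hi]
    · simp [hx, Ne.symm hx]
  rw [mul_smul, hsum, rhoXE_eq_sum_vecMulVec, Finset.smul_sum, ← Finset.sum_sub_distrib]
  refine Matrix.posSemidef_sum _ fun p _ => ?_
  rw [hvec]
  exact posSemidef_card_smul_sum_vecMulVec_sub S (u p)

theorem le_minEntropy_rhoXE {n : ℕ} (hn : 1 ≤ n) {κ : Type*} [Fintype κ]
    {lam : Bits n → Bits n → ℝ} (hlam : ∀ i j, 0 ≤ lam i j) (hsum : ∑ i, ∑ j, lam i j = 1)
    {e : Bits n × Bits n → EuclideanSpace ℂ κ} (he : Orthonormal ℂ e)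
    {q : ℝ} (hq0 : 0 ≤ q) (hq : q ≤ 1 / 2) (hS : ∀ i ∉ lowWeight n q, ∀ j, lam i j = 0) :
    (((n : ℝ) * (1 - binEntropyTwo q) : ℝ) : EReal) ≤ minEntropy (rhoXE lam e) := by
  have hσ := isState_eveState hlam hsum he
  refine le_sSup ⟨_, eveState lam e, rfl, hσ, ?_⟩
  set c : ℝ := 2 ^ (-((n : ℝ) * (1 - binEntropyTwo q))) with hc
  have hcard : ((lowWeight n q).card : ℝ) * (1 / 2) ^ n ≤ c := by
    have h2 : c = 2 ^ ((n : ℝ) * binEntropyTwo q) * (1 / 2) ^ n := by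
      rw [hc, show -((n : ℝ) * (1 - binEntropyTwo q)) = n * binEntropyTwo q - n by ring,
        Real.rpow_sub two_pos, Real.rpow_natCast, one_div, inv_pow, div_eq_mul_inv]
    rw [h2]
    exact mul_le_mul_of_nonneg_right (card_lowWeight_le hn hq0 hq) (by positivity)
  have h1 := posSemidef_smul_one_kronecker_eveState_sub_rhoXE hlam e (lowWeight n q) hS
  have h2 : (((c - (lowWeight n q).card * (1 / 2) ^ n : ℝ) : ℂ) •
      ((1 : Matrix (Bits n) (Bits n) ℂ) ⊗ₖ eveState lam e)).PosSemidef := by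
    refine (Matrix.PosSemidef.one.kronecker hσ.1).smul ?_
    exact_mod_cast sub_nonneg.mpr hcard
  convert h2.add h1 using 1
  push_cast
  rw [sub_smul]
  abel

/-! ### Smoothing -/

theorem mainTheorem7 {n : ℕ} (hn : 1 ≤ n) {κ : Type*} [Fintype κ] [DecidableEq κ]
    (lam : Bits n → Bits n → ℝ) (hlam : ∀ i j, 0 ≤ lam i j) (hsum : ∑ i, ∑ j, lam i j = 1)
    (e : Bits n × Bits n → EuclideanSpace ℂ κ) (he : Orthonormal ℂ e)
    (q : ℝ) (hq0 : 0 ≤ q) (hq : q ≤ 1 / 2) (ε : ℝ) (hε : 0 ≤ ε)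
    (hS : ∑ i ∈ lowWeight n q, marginal lam i = 1 - ε ^ 2) :
    (((n : ℝ) * (1 - binEntropyTwo q) : ℝ) : EReal) ≤ smoothMinEntropy ε (rhoXE lam e) := by
  suffices h : ∃ mu : Bits n → Bits n → ℝ, (∀ i j, 0 ≤ mu i j) ∧ ∑ i, ∑ j, mu i j = 1 ∧
      (∀ i ∉ lowWeight n q, ∀ j, mu i j = 0) ∧
      1 - (∑ i, ∑ j, Real.sqrt (lam i j) * Real.sqrt (mu i j)) ^ 2 ≤ ε ^ 2 by
    obtain ⟨mu, hmu, hmusum, hmuS, hF⟩ := h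
    refine le_iSup₂_of_le (rhoXE mu e) ⟨isSubnormalizedState_rhoXE hmu hmusum he, ?_⟩
      (le_minEntropy_rhoXE hn hmu hmusum he hq0 hq hmuS)
    rw [fidelity_rhoXE hlam mu he]
    exact Real.sqrt_le_iff.mpr ⟨hε, hF⟩
  have hpos : 0 ≤ 1 - ε ^ 2 := by
    rw [← hS]
    exact Finset.sum_nonneg fun i _ => Finset.sum_nonneg fun j _ => hlam i j
  have hext : ∀ f : Bits n → Bits n → ℝ, (∑ i, ∑ j, if i ∈ lowWeight n q then f i j else 0) =
      ∑ i ∈ lowWeight n q, ∑ j, f i j := by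
    intro f
    simp only [Finset.sum_ite_irrel, Finset.sum_const_zero, Finset.sum_ite_mem, Finset.univ_inter]
  rcases hpos.eq_or_lt with h0 | hpos
  -- For `ε² = 1` conditioning is undefined, but the distance condition is then vacuous. Any
  -- distribution supported on low weights works, such as the point mass at zero.
  · refine ⟨fun i j => if i = 0 then if j = 0 then 1 else 0 else 0, fun i j => ?_, ?_, ?_, ?_⟩
    · dsimp only
      split_ifs <;> norm_num
    · simp
    · intro i hi j
      refine if_neg fun h => hi ?_
      simp [h, lowWeight, hq0]
    · nlinarith [sq_nonneg (∑ i, ∑ j, Real.sqrt (lam i j) *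
        Real.sqrt (if i = 0 then if j = 0 then 1 else 0 else 0))]
  -- Conditioning `λ` on the low-weight set turns the fidelity into `(1 - ε²) / √(1 - ε²)`.
  · refine ⟨fun i j => if i ∈ lowWeight n q then lam i j / (1 - ε ^ 2) else 0,
      fun i j => ?_, ?_, fun i hi j => if_neg hi, ?_⟩
    · dsimp only
      split_ifs
      exacts [div_nonneg (hlam i j) hpos.le, le_rfl]
    · rw [hext]
      simp only [← Finset.sum_div]
      exact (congrArg (· / (1 - ε ^ 2)) hS).trans (div_self hpos.ne')
    · have h : ∀ i j, Real.sqrt (lam i j) *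
          Real.sqrt (if i ∈ lowWeight n q then lam i j / (1 - ε ^ 2) else 0) =
          if i ∈ lowWeight n q then lam i j / Real.sqrt (1 - ε ^ 2) else 0 := by
        intro i j
        split_ifs
        · rw [Real.sqrt_div (hlam i j), ← mul_div_assoc, Real.mul_self_sqrt (hlam i j)]
        · simp
      simp only [h]
      rw [hext]
      simp only [← Finset.sum_div]
      change 1 - ((∑ i ∈ lowWeight n q, marginal lam i) / _) ^ 2 ≤ _
      rw [hS, Real.div_sqrt, Real.sq_sqrt hpos.le]
      linarith
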